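/- **Setting.** Consider a $1$–$N$ generalized Stackelberg game $\Gamma$. The leader chooses $\mathbf y\in\Omega_{\mathrm L}=\{\mathbf y\in\mathbb R^{n_{\mathrm L}} : h_{\mathrm L}^j(\mathbf y)\le 0\ (j\le p_{\mathrm L}),\ l_{\mathrm L}^k(\mathbf y)=0\ (k\le q_{\mathrm L})\}$ to maximize $f_{\mathrm L}(\mathbf y,\mathbf x)$. Follower $i\in\{1,\dots,N\}$ chooses $\mathbf x_i\in\Omega_i(\mathbf y,\mathbf x_{-i})=\{\mathbf x_i\in\mathbb R^{n_i}: h_i^j(\mathbf y,\mathbf x)\le 0\ (j\le p_i),\ l_i^k(\mathbf y,\mathbf x)=0\ (k\le q_i)\}$ to maximize $f_i(\mathbf y,\mathbf x)$, where $\mathbf x=(\mathbf x_1,\dots,\mathbf x_N)$. Let $K(\mathbf y)=\{\mathbf x : \mathbf x_i\in\Omega_i(\mathbf y,\mathbf x_{-i})\ \forall i\}$ and $\mathbf D(\mathbf y,\mathbf x)=(\nabla_{\mathbf x_i}f_i(\mathbf y,\mathbf x))_{i}$. Let $\mathrm{VE}(\mathbf y)$ be the set of $\mathbf x\in K(\mathbf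 y)$ with $\mathbf D(\mathbf y,\mathbf x)^{\mathrm T}(\mathbf x-\mathbf x')\ge 0$ for all $\mathbf x'\in K(\mathbf y)$ (variational equilibria). A *variational Stackelberg equilibrium* of $\Gamma$ is a pair $(\mathbf y^*,\mathbf x^*)$ with $\mathbf y^*\in\Omega_{\mathrm L}$, $\mathbf x^*\in \mathrm{VE}(\mathbf y^*)$ and $$\sup_{\mathbf x\in \mathrm{VE}(\mathbf y^*)}f_{\mathrm L}(\mathbf y^*,\mathbf x)\ \ge\ \inf_{\mathbf x\in \mathrm{VE}(\mathbf y)}f_{\mathrm L}(\mathbf y,\mathbf x)\qquad\text{for all }\mathbf y\in\Omega_{\mathrm L},$$ with suprema and infima in $[-\infty,\infty]$. The $1$–$1$ Stackelberg game $\hat\Gamma$ has the same leader set $\Omega_{\mathrm L}$, and a single follower who chooses $\mathbf w=(\mathbf x,\mathbf z,\boldsymbol\lambda,\boldsymbol\mu)$ to maximize $f_{\mathrm F}(\mathbf y,\mathbf w)=\mathbf D(\mathbf y,\mathbf x)^{\mathrm T}(\mathbf x-\mathbf z)$ over the set $\Omega_{\mathrm F}(\mathbf y)$ of all $\mathbf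 w$ such that $$-\mathbf D(\mathbf y,\mathbf x)+\sum_{i,j}\lambda_i^j\nabla_{\mathbf z}h_i^j(\mathbf y,\mathbf z)+\sum_{i,k}\mu_i^k\nabla_{\mathbf z}l_i^k(\mathbf y,\mathbf z)=\mathbf 0$$ and, for all $i,j,k$, $h_i^j(\mathbf y,\mathbf x)\le0$, $l_i^k(\mathbf y,\mathbf x)=0$, $\lambda_i^jh_i^j(\mathbf y,\mathbf z)=0$, $h_i^j(\mathbf y,\mathbf z)\le 0$, $l_i^k(\mathbf y,\mathbf z)=0$, $\lambda_i^j\ge0$. The leader's objective is $f_{\mathrm L}(\mathbf y,\mathbf x)$, with $\mathbf x$ the first component of $\mathbf w$. Let $\mathrm{BR}(\mathbf y)=\operatorname{argmax}_{\mathbf w\in\Omega_{\mathrm F}(\mathbf y)}f_{\mathrm F}(\mathbf y,\mathbf w)$. A *Stackelberg equilibrium* of $\hat\Gamma$ is a pair $(\mathbf y^*,\mathbf w^*)$ with $\mathbf y^*\in\Omega_{\mathrm L}$, $\mathbf w^*\in\mathrm{BR}(\mathbf y^*)$ and $\sup_{\mathbf w\in\mathrm{BR}(\mathbf y^*)}f_{\mathrm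 L}(\mathbf y^*,\mathbf x)\ge\inf_{\mathbf w\in\mathrm{BR}(\mathbf y)}f_{\mathrm L}(\mathbf y,\mathbf x)$ for all $\mathbf y\in\Omega_{\mathrm L}$. **Theorem 4.** Suppose that for every $\mathbf y\in\Omega_{\mathrm L}$: 1. for all $\mathbf x\in K(\mathbf y)$ and all $i$, $\Omega_i(\mathbf y,\mathbf x_{-i})$ is closed and convex; 2. for all $\mathbf x\in K(\mathbf y)$ and all $i$, $f_i(\mathbf y,\cdot,\mathbf x_{-i})$ is concave on $\Omega_i(\mathbf y,\mathbf x_{-i})$, and $f_i(\mathbf y,\cdot)$ is $C^1$ in a neighbourhood of each point of $K(\mathbf y)$; 3. $K(\mathbf y)$ is convex; 4. $-\mathbf D(\mathbf y,\cdot)$ is strongly monotone on $K(\mathbf y)$; 5. all functions $h_i^j(\mathbf y,\cdot)$ and $l_i^k(\mathbf y,\cdot)$ are differentiable, and Abadie's constraint qualification holds at every $\mathbf z\in K(\mathbf y)$: every direction $\mathbf d$ with $\nabla_{\mathbf z}h_i^j(\mathbf y,\mathbf z)^{\mathrm T}\mathbf d\le0$ for all active inequality constraints ($h_i^j(\mathbf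 y,\mathbf z)=0$) and $\nabla_{\mathbf z}l_i^k(\mathbf y,\mathbf z)^{\mathrm T}\mathbf d=0$ for all $i,k$ lies in the (Bouligand) tangent cone of $K(\mathbf y)$ at $\mathbf z$. Then the set of variational Stackelberg equilibria of $\Gamma$ equals the set of Stackelberg equilibria of $\hat\Gamma$, where $(\mathbf y,\mathbf w)$ with $\mathbf w=(\mathbf x,\mathbf z,\boldsymbol\lambda,\boldsymbol\mu)$ is identified with its decision part $(\mathbf y,\mathbf x)$; that is, $$\{\text{variational Stackelberg equilibria of }\Gamma\}=\{(\mathbf y,\mathbf x) : (\mathbf y,(\mathbf x,\mathbf z,\boldsymbol\lambda,\boldsymbol\mu))\text{ is a Stackelberg equilibrium of }\hat\Gamma\text{ for some }\mathbf z,\boldsymbol\lambda,\boldsymbol\mu\}.$$ -/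

import Mathlib

/-! # One-leader / many-follower generalized Stackelberg games and their single-follower reformulation -/

namespace Stackelberg

noncomputable section

/-- Joint decisions `x = (x₁, …, x_N)` of the followers, with `xᵢ ∈ ℝ^{nᵢ}`. -/
abbrev Profile {N : ℕ} (n : Fin N → ℕ) : Type :=
  (i : Fin N) → EuclideanSpace ℝ (Fin (n i))

/-- The Euclidean inner product `uᵀ v` on `ℝ^{n₁ + ⋯ + n_N}`, computed block by block. -/
def dot {N : ℕ} {n : Fin N → ℕ} (u v : Profile n) : ℝ :=
  ∑ i, inner ℝ (u i) (v i)

/-- The partial gradient `∇_{xᵢ} g (x) ∈ ℝ^{nᵢ}` with respect to the `i`-th block. -/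
def partialGrad {N : ℕ} {n : Fin N → ℕ} (g : Profile n → ℝ) (x : Profile n) (i : Fin N) :
    EuclideanSpace ℝ (Fin (n i)) :=
  gradient (fun u : EuclideanSpace ℝ (Fin (n i)) => g (Function.update x i u)) (x i)

/-- The gradient `∇ₓ g (x) = (∇_{xᵢ} g (x))ᵢ` with respect to the joint decision. -/
def fullGrad {N : ℕ} {n : Fin N → ℕ} (g : Profile n → ℝ) (x : Profile n) : Profile n :=
  fun i => partialGrad g x i

/-- Data of a `1-N` generalized Stackelberg game: the leader has decisions in `ℝ^{nL}`, `pL`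
inequality and `qL` equality constraints; follower `i` has decisions in `ℝ^{nᵢ}`, `pᵢ` inequality
and `qᵢ` equality constraints, which may involve the decisions of the leader and of all
followers. All players maximize. -/
structure MultiFollowerGame (N nL pL qL : ℕ) (n p q : Fin N → ℕ) where
  /-- objective of the leader -/
  fL : EuclideanSpace ℝ (Fin nL) → Profile n → ℝ
  /-- objectives of the followers -/
  f : Fin N → EuclideanSpace ℝ (Fin nL) → Profile n → ℝ
  /-- inequality constraints of the leader -/
  hL : Fin pL → EuclideanSpace ℝ (Fin nL) → ℝ
  /-- equality constraints of the leader -/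
  lL : Fin qL → EuclideanSpace ℝ (Fin nL) → ℝ
  /-- inequality constraints of the followers -/
  h : (i : Fin N) → Fin (p i) → EuclideanSpace ℝ (Fin nL) → Profile n → ℝ
  /-- equality constraints of the followers -/
  l : (i : Fin N) → Fin (q i) → EuclideanSpace ℝ (Fin nL) → Profile n → ℝ

/-- Data of a `1-1` Stackelberg game: decision spaces `Y` (leader) and `W` (follower), objectives
(both players maximize), strategy set of the leader, and strategy set of the follower, which
depends on the decision of the leader. -/
structure SingleFollowerGame (Y W : Type*) where
  /-- objective of the leader -/
  fL : Y → W → ℝ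
  /-- objective of the follower -/
  fF : Y → W → ℝ
  /-- strategy set of the leader -/
  leaderSet : Set Y
  /-- strategy set of the follower -/
  followerSet : Y → Set W

namespace SingleFollowerGame

variable {Y W : Type*} (G : SingleFollowerGame Y W)

/-- The follower's optimal responses `argmax_{w ∈ Ω_F(y)} f_F(y, w)`. -/
def bestResponses (y : Y) : Set W :=
  {w | w ∈ G.followerSet y ∧ ∀ w' ∈ G.followerSet y, G.fF y w' ≤ G.fF y w}

/-- The Stackelberg equilibria: pairs `(y, w)` with `y ∈ Ω_L`, `w` an optimal response to `y`, and
`sup_{v ∈ BR(y)} f_L(y, v) ≥ inf_{v ∈ BR(y')} f_L(y', v)` for all `y' ∈ Ω_L`. Suprema and infima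
are taken in the extended reals. -/
def stackelbergEquilibria : Set (Y × W) :=
  {e | e.1 ∈ G.leaderSet ∧ e.2 ∈ G.bestResponses e.1 ∧
    ∀ y' ∈ G.leaderSet,
      (⨅ v ∈ G.bestResponses y', (G.fL y' v : EReal)) ≤
        ⨆ v ∈ G.bestResponses e.1, (G.fL e.1 v : EReal)}

end SingleFollowerGame

/-- Decisions `w = (x, z, λ, μ)` of the fictitious follower. -/
structure FollowerDecision {N : ℕ} (n p q : Fin N → ℕ) where
  /-- joint decision of the original followers -/
  x : Profile n
  /-- decision of the inner minimization problem -/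
  z : Profile n
  /-- multipliers of the inequality constraints -/
  lam : (i : Fin N) → Fin (p i) → ℝ
  /-- multipliers of the equality constraints -/
  mu : (i : Fin N) → Fin (q i) → ℝ

namespace MultiFollowerGame

variable {N nL pL qL : ℕ} {n p q : Fin N → ℕ} (G : MultiFollowerGame N nL pL qL n p q)

/-- The strategy set `Ω_L` of the leader. -/
def leaderSet : Set (EuclideanSpace ℝ (Fin nL)) :=
  {y | (∀ j, G.hL j y ≤ 0) ∧ ∀ k, G.lL k y = 0}

/-- The strategy set `Ωᵢ(y, x₋ᵢ)` of follower `i` (the `i`-th block of `x` is not used). -/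
def strategySet (i : Fin N) (y : EuclideanSpace ℝ (Fin nL)) (x : Profile n) :
    Set (EuclideanSpace ℝ (Fin (n i))) :=
  {u | (∀ j, G.h i j y (Function.update x i u) ≤ 0) ∧
    ∀ k, G.l i k y (Function.update x i u) = 0}

/-- The joint feasible set: profiles `x` with `x ∈ ∏ᵢ Ωᵢ(y, x₋ᵢ)`. -/
def jointSet (y : EuclideanSpace ℝ (Fin nL)) : Set (Profile n) :=
  {x | ∀ i, x i ∈ G.strategySet i y x}

/-- `D(y, x) = (∇_{xᵢ} fᵢ(y, x))ᵢ`, the joint gradient of the followers' objectives. -/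
def pseudoGrad (y : EuclideanSpace ℝ (Fin nL)) (x : Profile n) : Profile n :=
  fun i => partialGrad (G.f i y) x i

/-- The variational equilibria of the followers' subgame at the leader's decision `y`. -/
def variationalEquilibria (y : EuclideanSpace ℝ (Fin nL)) : Set (Profile n) :=
  {x | x ∈ G.jointSet y ∧ ∀ x' ∈ G.jointSet y, 0 ≤ dot (G.pseudoGrad y x) (x - x')}

/-- The variational Stackelberg equilibria: pairs `(y, x)` with `y ∈ Ω_L`, `x ∈ VE(y)` and
`sup_{v ∈ VE(y)} f_L(y, v) ≥ inf_{v ∈ VE(y')} f_L(y', v)` for all `y' ∈ Ω_L`. Suprema and infima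
are taken in the extended reals. -/
def variationalStackelbergEquilibria : Set (EuclideanSpace ℝ (Fin nL) × Profile n) :=
  {e | e.1 ∈ G.leaderSet ∧ e.2 ∈ G.variationalEquilibria e.1 ∧
    ∀ y' ∈ G.leaderSet,
      (⨅ v ∈ G.variationalEquilibria y', (G.fL y' v : EReal)) ≤
        ⨆ v ∈ G.variationalEquilibria e.1, (G.fL e.1 v : EReal)}

/-- The strategy set `Ω_F(y)` of the fictitious follower: the original constraints on `x`, and the
KKT system at `z` of the problem of minimizing `D(y, x)ᵀ (x - z)` over `z ∈ ∏ᵢ Ωᵢ(y, z₋ᵢ)`. -/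
def kktSet (y : EuclideanSpace ℝ (Fin nL)) : Set (FollowerDecision n p q) :=
  {w | -G.pseudoGrad y w.x + (∑ i, ∑ j, w.lam i j • fullGrad (G.h i j y) w.z)
        + (∑ i, ∑ k, w.mu i k • fullGrad (G.l i k y) w.z) = 0 ∧
    (∀ i j, G.h i j y w.x ≤ 0) ∧
    (∀ i k, G.l i k y w.x = 0) ∧
    (∀ i j, w.lam i j * G.h i j y w.z = 0) ∧
    (∀ i j, G.h i j y w.z ≤ 0) ∧
    (∀ i k, G.l i k y w.z = 0) ∧
    (∀ i j, 0 ≤ w.lam i j)}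

/-- The `1-1` Stackelberg game with one fictitious follower, who chooses `w = (x, z, λ, μ)` so as
to maximize `D(y, x)ᵀ (x - z)` over `Ω_F(y)`. -/
def toSingleFollower :
    SingleFollowerGame (EuclideanSpace ℝ (Fin nL)) (FollowerDecision n p q) where
  fL y w := G.fL y w.x
  fF y w := dot (G.pseudoGrad y w.x) (w.x - w.z)
  leaderSet := G.leaderSet
  followerSet := G.kktSet

/-- `-D(y, ·)` is strongly monotone on the set `s`. -/
def StronglyMonotoneNegGradOn (y : EuclideanSpace ℝ (Fin nL)) (s : Set (Profile n)) : Prop :=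
  ∃ c : ℝ, 0 < c ∧ ∀ x ∈ s, ∀ x' ∈ s,
    c * dot (x - x') (x - x') ≤ dot (-G.pseudoGrad y x - -G.pseudoGrad y x') (x - x')

/-- The linearized cone at `z` of the joint constraint system at the leader's decision `y`:
directions that are non-ascending for the active inequality constraints and stationary for the
equality constraints. -/
def linearizedCone (y : EuclideanSpace ℝ (Fin nL)) (z : Profile n) : Set (Profile n) :=
  {d | (∀ i j, G.h i j y z = 0 → dot (fullGrad (G.h i j y) z) d ≤ 0) ∧
    ∀ i k, dot (fullGrad (G.l i k y) z) d = 0}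

/-- Abadie's constraint qualification at `z`: every linearized direction is tangent to the joint
feasible set (in the sense of the Bouligand tangent cone). -/
def AbadieCQ (y : EuclideanSpace ℝ (Fin nL)) (z : Profile n) : Prop :=
  G.linearizedCone y z ⊆ posTangentConeAt (G.jointSet y) z

end MultiFollowerGame

end

end Stackelberg

/-! Everything rests on `image_x_bestResponses`: for each `y` in the leader's set, the `x`-parts of
the best responses are exactly the variational equilibria. Both equilibrium notions then compare the
same infima and suprema, since the leader's objective sees only `x`.

Let K be the joint feasible set. A KKT point z minimizes D(y, x)ᵀ(x - z') over z' in K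
(`dot_sub_z_le_of_mem_kktSet`; convexity of K suffices). Taking z' = x shows that the fictitious
follower never gets more than 0, and value 0 says precisely that x solves the variational
inequality. Conversely, at a variational equilibrium x, Abadie's condition and Farkas' lemma give
multipliers for z = x, so 0 is attained. Best responses are thus the points of value 0 once some
variational equilibrium exists. Strong monotonicity provides one when K is nonempty. The existence
proof avoids fixed points: finitely many Minty inequalities are solved by a theorem of the
alternative, compactness solves them all, and continuity recovers the original inequality. -/

/-! ### Farkas' lemma and a theorem of the alternative -/

/-- Farkas' lemma for finitely many linear functionals, by induction on their number. -/
theorem exists_nonneg_combination_of_forall_nonpos {V ι : Type*} [AddCommGroup V] [Module ℝ V]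
    (s : Finset ι) (a : ι → V →ₗ[ℝ] ℝ) (b : V →ₗ[ℝ] ℝ)
    (hab : ∀ v, (∀ i ∈ s, a i v ≤ 0) → b v ≤ 0) :
    ∃ c : ι → ℝ, (∀ i, 0 ≤ c i) ∧ b = ∑ i ∈ s, c i • a i := by
  classical
  induction s using Finset.induction_on generalizing a b with
  | empty =>
    refine ⟨0, fun _ => le_rfl, LinearMap.ext fun v => ?_⟩
    have h₁ := hab v (by simp)
    have h₂ := hab (-v) (by simp)
    simp only [map_neg] at h₂
    simp only [Finset.sum_empty, LinearMap.zero_apply]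
    linarith
  | insert k s hk ih =>
    by_cases hs : ∀ v, (∀ i ∈ s, a i v ≤ 0) → b v ≤ 0
    · obtain ⟨c, hc, hbc⟩ := ih a b hs
      refine ⟨Function.update c k 0, fun i => ?_, ?_⟩
      · rcases eq_or_ne i k with rfl | hi
        · simp
        · simpa [hi] using hc i
      · rw [Finset.sum_insert hk, hbc]
        simp only [Function.update_self, zero_smul, zero_add]
        refine Finset.sum_congr rfl fun i hi => ?_
        rw [Function.update_of_ne (ne_of_mem_of_not_mem hi hk)]
    · push Not at hs
      obtain ⟨v₀, hv₀, hbv₀⟩ := hs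
      have hak : 0 < a k v₀ := by
        by_contra! hle
        refine hbv₀.not_ge (hab v₀ fun i hi => ?_)
        rcases Finset.mem_insert.1 hi with rfl | hi
        exacts [hle, hv₀ i hi]
      set r := a k v₀
      -- Precompose all functionals with the projection v ↦ v - (a k v / r) • v₀ onto the kernel of
      -- `a k`; the constraint `k` then holds automatically, and the induction hypothesis applies.
      obtain ⟨c, hc, hbc⟩ := ih (fun i => a i - (a i v₀ / r) • a k) (b - (b v₀ / r) • a k) (by
        intro v hv
        have key : ∀ g : V →ₗ[ℝ] ℝ,
            (g - (g v₀ / r) • a k) v = g (v - (a k v / r) • v₀) := by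
          intro g
          simp only [LinearMap.sub_apply, LinearMap.smul_apply, map_sub, map_smul, smul_eq_mul]
          ring
        rw [key]
        refine hab _ fun i hi => ?_
        rcases Finset.mem_insert.1 hi with rfl | hi
        · simp only [map_sub, map_smul, smul_eq_mul]
          rw [div_mul_cancel₀ _ hak.ne', sub_self]
        · rw [← key]
          exact hv i hi)
      have hcs : ∑ i ∈ s, c i * (a i v₀ / r) ≤ 0 :=
        Finset.sum_nonpos fun i hi =>
          mul_nonpos_of_nonneg_of_nonpos (hc i) (div_nonpos_of_nonpos_of_nonneg (hv₀ i hi) hak.le)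
      -- Undoing the projection fixes this coefficient of `a k`. It is positive because b v₀ > 0,
      -- while a i v₀ ≤ 0 on `s`.
      refine ⟨Function.update c k (b v₀ / r - ∑ i ∈ s, c i * (a i v₀ / r)), fun i => ?_, ?_⟩
      · rcases eq_or_ne i k with rfl | hi
        · simp only [Function.update_self]
          have := div_pos hbv₀ hak
          linarith
        · simpa [hi] using hc i
      · rw [Finset.sum_insert hk, Function.update_self]
        have hsum : ∑ i ∈ s, Function.update c k
            (b v₀ / r - ∑ i ∈ s, c i * (a i v₀ / r)) i • a i = ∑ i ∈ s, c i • a i :=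
          Finset.sum_congr rfl fun i hi => by
            rw [Function.update_of_ne (ne_of_mem_of_not_mem hi hk)]
        rw [hsum]
        generalize b v₀ / r = β at hbc ⊢
        rw [eq_add_of_sub_eq hbc]
        ext v
        simp only [LinearMap.add_apply, LinearMap.sum_apply, LinearMap.smul_apply,
          LinearMap.sub_apply, smul_eq_mul, mul_sub, sub_mul, Finset.sum_sub_distrib,
          Finset.sum_mul, mul_assoc]
        ring

/-- Farkas' lemma with inequality constraints, some of them inactive, and equality constraints. -/
theorem exists_multipliers_of_forall_nonpos {V α β : Type*} [AddCommGroup V] [Module ℝ V]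
    [Fintype α] [Fintype β] (act : α → Prop) (a : α → V →ₗ[ℝ] ℝ) (e : β → V →ₗ[ℝ] ℝ)
    (b : V →ₗ[ℝ] ℝ)
    (hab : ∀ v, (∀ i, act i → a i v ≤ 0) → (∀ k, e k v = 0) → b v ≤ 0) :
    ∃ (c : α → ℝ) (m : β → ℝ), (∀ i, 0 ≤ c i) ∧ (∀ i, ¬ act i → c i = 0) ∧
      b = ∑ i, c i • a i + ∑ k, m k • e k := by
  classical
  -- Inactive constraints become the zero functional, and each equality becomes a pair of opposite
  -- inequalities.
  obtain ⟨c, hc, hb⟩ := exists_nonneg_combination_of_forall_nonpos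
    (Finset.univ : Finset (α ⊕ β ⊕ β))
    (Sum.elim (fun i => if act i then a i else 0) (Sum.elim e fun k => -e k)) b (by
      intro v hv
      refine hab v (fun i hi => ?_) fun k => le_antisymm ?_ ?_
      · simpa [hi] using hv (.inl i) (Finset.mem_univ _)
      · simpa using hv (.inr (.inl k)) (Finset.mem_univ _)
      · simpa using hv (.inr (.inr k)) (Finset.mem_univ _))
  refine ⟨fun i => if act i then c (.inl i) else 0,
    fun k => c (.inr (.inl k)) - c (.inr (.inr k)), fun i => ?_, fun i hi => if_neg hi, ?_⟩
  · dsimp only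
    split_ifs
    exacts [hc _, le_rfl]
  · rw [hb]
    ext v
    simp [Fintype.sum_sum_type, sub_mul, ite_smul, ← sub_eq_add_neg]

/-- A square matrix whose quadratic form is nonnegative on the nonnegative orthant admits a
nonzero nonnegative vector with nonnegative image. -/
theorem exists_nonneg_mulVec_nonneg {ι : Type*} [Fintype ι] [Nonempty ι] (A : ι → ι → ℝ)
    (hA : ∀ s : ι → ℝ, (∀ i, 0 ≤ s i) → 0 ≤ ∑ i, s i * ∑ j, A i j * s j) :
    ∃ t : ι → ℝ, (∀ i, 0 ≤ t i) ∧ 0 < ∑ i, t i ∧ ∀ i, 0 ≤ ∑ j, A i j * t j := by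
  classical
  by_contra! hne
  let row : ι → (ι → ℝ) →ₗ[ℝ] ℝ := fun i => ∑ j, A i j • LinearMap.proj j
  have hrow : ∀ i t, row i t = ∑ j, A i j * t j := fun i t => by simp [row]
  -- If no such vector exists, then ∑ t i ≤ 0 whenever t ≥ 0 and A t ≥ 0, and Farkas certifies this.
  obtain ⟨c, hc, hsum⟩ := exists_nonneg_combination_of_forall_nonpos
    (Finset.univ : Finset (ι ⊕ ι))
    (Sum.elim (fun i => -LinearMap.proj i) fun i => -row i) (∑ i, LinearMap.proj i) (by
      intro t ht
      have h₁ : ∀ i, 0 ≤ t i := fun i => by simpa using ht (.inl i) (Finset.mem_univ _)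
      have h₂ : ∀ i, 0 ≤ ∑ j, A i j * t j := fun i => by
        simpa [hrow] using ht (.inr i) (Finset.mem_univ _)
      by_contra! hpos
      obtain ⟨i, hi⟩ := hne t h₁ (by simpa using hpos)
      exact hi.not_ge (h₂ i))
  have key : ∀ t : ι → ℝ, ∑ i, t i =
      -(∑ i, c (.inl i) * t i) - ∑ i, c (.inr i) * ∑ j, A i j * t j := fun t => by
    have := congrArg (fun g => g t) hsum
    simpa [Fintype.sum_sum_type, hrow, sub_eq_add_neg] using this
  -- Evaluating the certificate at its own multipliers of the rows of `A` forces them to vanish;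
  -- evaluating it at the all-ones vector then gives the contradiction.
  have hs₁ := key fun i => c (.inr i)
  have hs₂ := hA (fun i => c (.inr i)) fun i => hc _
  have hs₃ : 0 ≤ ∑ i, c (.inl i) * c (.inr i) :=
    Finset.sum_nonneg fun i _ => mul_nonneg (hc _) (hc _)
  have hzero : ∀ i, c (.inr i) = 0 := fun i =>
    (Finset.sum_eq_zero_iff_of_nonneg fun i _ => hc (.inr i)).1
      (le_antisymm (by linarith) (Finset.sum_nonneg fun i _ => hc _)) i (Finset.mem_univ i)
  have hone := key fun _ => 1
  simp only [hzero, mul_one, zero_mul, Finset.sum_const_zero, sub_zero, Finset.sum_const,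
    Finset.card_univ, nsmul_eq_mul] at hone
  have hcard : (0 : ℝ) < Fintype.card ι := by exact_mod_cast Fintype.card_pos
  have : 0 ≤ ∑ i, c (.inl i) := Finset.sum_nonneg fun i _ => hc _
  linarith

/-! ### Variational inequalities for monotone operators -/

section VariationalInequality

variable {E : Type*} [NormedAddCommGroup E] [NormedSpace ℝ E]

/-- Finitely many Minty inequalities of a monotone operator have a common solution. -/
theorem exists_mem_forall_finset_minty {K : Set E} (hK : Convex ℝ K) {F : E → E →L[ℝ] ℝ}
    (hF : ∀ x ∈ K, ∀ y ∈ K, 0 ≤ (F x - F y) (x - y)) (u : Finset E) (hu : u.Nonempty)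
    (huK : ∀ y ∈ u, y ∈ K) : ∃ x ∈ K, ∀ y ∈ u, 0 ≤ F y (y - x) := by
  have : Nonempty u := hu.to_subtype
  -- Symmetrizing the quadratic form of the matrix F y (y - x) yields the differences (F y - F x) (y
  -- - x), which are nonnegative by monotonicity. The vector `t`, normalized, gives the convex
  -- weights of the solution.
  obtain ⟨t, ht, hpos, hrow⟩ := exists_nonneg_mulVec_nonneg
    (fun y x : u => F y ((y : E) - x)) (by
      intro s hs
      have hdouble : ∑ y : u, s y * ∑ x : u, F y ((y : E) - x) * s x
          = ∑ y : u, ∑ x : u, s y * s x * F y ((y : E) - x) := by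
        refine Finset.sum_congr rfl fun y _ => ?_
        rw [Finset.mul_sum]
        exact Finset.sum_congr rfl fun x _ => by ring
      have hswap : ∑ y : u, ∑ x : u, s y * s x * F y ((y : E) - x)
          = ∑ y : u, ∑ x : u, s y * s x * F x ((x : E) - y) := by
        rw [Finset.sum_comm]
        exact Finset.sum_congr rfl fun x _ => Finset.sum_congr rfl fun y _ => by ring
      have hnonneg : 0 ≤ ∑ y : u, ∑ x : u, s y * s x * F y ((y : E) - x)
          + ∑ y : u, ∑ x : u, s y * s x * F x ((x : E) - y) := by
        rw [← Finset.sum_add_distrib]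
        refine Finset.sum_nonneg fun y _ => ?_
        rw [← Finset.sum_add_distrib]
        refine Finset.sum_nonneg fun x _ => ?_
        have h₁ := hF y (huK y y.2) x (huK x x.2)
        have h₂ : F x ((x : E) - y) = -F x ((y : E) - x) := by rw [← map_neg, neg_sub]
        rw [sub_apply] at h₁
        rw [h₂]
        nlinarith [mul_nonneg (mul_nonneg (hs y) (hs x)) h₁]
      rw [hdouble]
      linarith)
  refine ⟨∑ x : u, (t x / ∑ i, t i) • (x : E), ?_, fun y hy => ?_⟩
  · refine hK.sum_mem (fun x _ => div_nonneg (ht x) hpos.le) ?_ fun x _ => huK x x.2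
    rw [← Finset.sum_div, div_self hpos.ne']
  · have hy' : y = ∑ x : u, (t x / ∑ i, t i) • y := by
      rw [← Finset.sum_smul, ← Finset.sum_div, div_self hpos.ne', one_smul]
    have : F y (y - ∑ x : u, (t x / ∑ i, t i) • (x : E))
        = (∑ x : u, F y (y - x) * t x) / ∑ i, t i := by
      nth_rewrite 2 [hy']
      rw [← Finset.sum_sub_distrib, map_sum, Finset.sum_div]
      refine Finset.sum_congr rfl fun x _ => ?_
      rw [← smul_sub, map_smul, smul_eq_mul]
      ring
    rw [this]
    exact div_nonneg (hrow ⟨y, hy⟩) hpos.le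

/-- Hartman–Stampacchia for monotone operators: a variational inequality over a nonempty compact
convex set has a solution. -/
theorem exists_variationalInequality_of_isCompact {K : Set E} (hK : Convex ℝ K)
    (hKc : IsCompact K) (hne : K.Nonempty) {F : E → E →L[ℝ] ℝ} (hFc : ContinuousOn F K)
    (hF : ∀ x ∈ K, ∀ y ∈ K, 0 ≤ (F x - F y) (x - y)) :
    ∃ x ∈ K, ∀ y ∈ K, 0 ≤ F x (y - x) := by
  classical
  obtain ⟨x, hxK, hx⟩ : (K ∩ ⋂ y : K, {x | 0 ≤ F y ((y : E) - x)}).Nonempty := by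
    refine hKc.inter_iInter_nonempty _ (fun y => ?_) fun u => ?_
    · exact isClosed_le continuous_const (by fun_prop)
    · rcases u.eq_empty_or_nonempty with rfl | hu
      · simpa using hne
      · obtain ⟨x, hxK, hx⟩ := exists_mem_forall_finset_minty hK hF (u.image Subtype.val)
          (hu.image _) (by simp +contextual)
        exact ⟨x, hxK, Set.mem_iInter₂.2 fun y hy => hx y (Finset.mem_image_of_mem _ hy)⟩
  rw [Set.mem_iInter] at hx
  refine ⟨x, hxK, fun y hyK => ?_⟩
  -- Minty's trick: test at points of the segment towards `y`, divide by `t`, and let `t` tend to 0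
  -- from the right.
  let γ : ℝ → E := fun t => x + t • (y - x)
  have hγK : ∀ t ∈ Set.Ioc (0 : ℝ) 1, γ t ∈ K := fun t ht =>
    hK.add_smul_sub_mem hxK hyK ⟨ht.1.le, ht.2⟩
  have hev : ∀ᶠ t in nhdsWithin (0 : ℝ) (Set.Ioi 0), t ∈ Set.Ioc (0 : ℝ) 1 :=
    Ioc_mem_nhdsGT one_pos
  have hγ : Filter.Tendsto γ (nhdsWithin 0 (Set.Ioi 0)) (nhdsWithin x K) := by
    refine tendsto_nhdsWithin_iff.2 ⟨?_, hev.mono hγK⟩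
    have : Continuous γ := by fun_prop
    simpa [γ] using (this.tendsto 0).mono_left nhdsWithin_le_nhds
  have hlim : Filter.Tendsto (fun t => F (γ t) (y - x)) (nhdsWithin 0 (Set.Ioi 0))
      (nhds (F x (y - x))) :=
    ((ContinuousLinearMap.apply ℝ ℝ (y - x)).continuous.tendsto _).comp
      ((hFc x hxK).tendsto.comp hγ)
  refine ge_of_tendsto hlim (hev.mono fun t ht => ?_)
  have h := hx ⟨γ t, hγK t ht⟩
  simp only [Set.mem_ofPred_eq, γ, add_sub_cancel_left, map_smul, smul_eq_mul] at h
  exact nonneg_of_mul_nonneg_right h ht.1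

/-- A variational inequality for a continuous strongly monotone operator over a nonempty closed
convex set has a solution. -/
theorem exists_variationalInequality_of_stronglyMonotone [ProperSpace E] {K : Set E}
    (hK : Convex ℝ K) (hKc : IsClosed K) (hne : K.Nonempty) {F : E → E →L[ℝ] ℝ}
    (hFc : ContinuousOn F K) {c : ℝ} (hc : 0 < c)
    (hF : ∀ x ∈ K, ∀ y ∈ K, c * ‖x - y‖ ^ 2 ≤ (F x - F y) (x - y)) :
    ∃ x ∈ K, ∀ y ∈ K, 0 ≤ F x (y - x) := by
  obtain ⟨x₀, hx₀⟩ := hne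
  -- Strong monotonicity bounds the distance from a solution to `x₀` by ‖F x₀‖ / c; the extra 1
  -- keeps the solution off the boundary of the ball.
  set R : ℝ := ‖F x₀‖ / c + 1
  have hR : 0 < R := by positivity
  obtain ⟨x, ⟨hxK, hxR⟩, hx⟩ := exists_variationalInequality_of_isCompact
    (hK.inter (convex_closedBall x₀ R)) ((isCompact_closedBall x₀ R).inter_left hKc)
    ⟨x₀, hx₀, Metric.mem_closedBall_self hR.le⟩ (hFc.mono Set.inter_subset_left)
    (fun x hx y hy => le_trans (by positivity) (hF x hx.1 y hy.1))
  have hlt : ‖x - x₀‖ < R := by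
    have h₁ := hx x₀ ⟨hx₀, Metric.mem_closedBall_self hR.le⟩
    have h₂ := hF x hxK x₀ hx₀
    have h₃ : F x₀ (x₀ - x) ≤ ‖F x₀‖ * ‖x - x₀‖ := by
      rw [← norm_sub_rev x₀ x]
      exact (le_abs_self _).trans ((F x₀).le_opNorm _)
    have h₄ : (F x - F x₀) (x - x₀) = -F x (x₀ - x) + F x₀ (x₀ - x) := by
      rw [sub_apply, ← neg_sub x₀ x, map_neg, map_neg]
      ring
    have h₅ : c * ‖x - x₀‖ ^ 2 ≤ ‖F x₀‖ * ‖x - x₀‖ := by linarith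
    rcases (norm_nonneg (x - x₀)).eq_or_lt with h₀ | h₀
    · rw [← h₀]
      exact hR
    · have h₆ : c * ‖x - x₀‖ ≤ ‖F x₀‖ := by
        refine le_of_mul_le_mul_right ?_ h₀
        linarith [h₅, sq ‖x - x₀‖]
      have : ‖x - x₀‖ ≤ ‖F x₀‖ / c := (le_div_iff₀' hc).2 h₆
      exact this.trans_lt (lt_add_one _)
  refine ⟨x, hxK, fun y hy => ?_⟩
  -- As `x` is interior to the ball, a short step towards any `y` in `K` stays inside it, and
  -- linearity rescales the inequality.
  have hev : ∀ᶠ t in nhdsWithin (0 : ℝ) (Set.Ioi 0), ‖x + t • (y - x) - x₀‖ < R := by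
    have hcont : Continuous fun t : ℝ => ‖x + t • (y - x) - x₀‖ := by fun_prop
    exact nhdsWithin_le_nhds (hcont.tendsto 0 |>.eventually_lt_const (by simpa using hlt))
  obtain ⟨t, htR, ht⟩ := (hev.and (Ioc_mem_nhdsGT one_pos)).exists
  have h := hx (x + t • (y - x)) ⟨hK.add_smul_sub_mem hxK hy ⟨ht.1.le, ht.2⟩,
    by simpa [dist_eq_norm] using htR.le⟩
  simp only [add_sub_cancel_left, map_smul, smul_eq_mul] at h
  exact nonneg_of_mul_nonneg_right h ht.1

end VariationalInequality

namespace Stackelberg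

/-! ### The blockwise inner product and gradients -/

section Dot

variable {N : ℕ} {n : Fin N → ℕ}

/-- The bilinear form `dot`. -/
noncomputable def dotBilin (n : Fin N → ℕ) : Profile n →ₗ[ℝ] Profile n →ₗ[ℝ] ℝ :=
  LinearMap.mk₂ ℝ dot
    (fun u u' v => by simp [dot, inner_add_left, Finset.sum_add_distrib])
    (fun c u v => by simp [dot, inner_smul_left, Finset.mul_sum])
    (fun u v v' => by simp [dot, inner_add_right, Finset.sum_add_distrib])
    (fun c u v => by simp [dot, inner_smul_right, Finset.mul_sum])

@[simp]
theorem dotBilin_apply (u v : Profile n) : dotBilin n u v = dot u v := rfl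

theorem dot_neg_left (u v : Profile n) : dot (-u) v = -dot u v := by
  simp only [← dotBilin_apply, map_neg, LinearMap.neg_apply]

theorem dot_sub_left (u u' v : Profile n) : dot (u - u') v = dot u v - dot u' v := by
  simp only [← dotBilin_apply, map_sub, LinearMap.sub_apply]

theorem dot_neg_right (u v : Profile n) : dot u (-v) = -dot u v := by
  simp only [← dotBilin_apply, map_neg]

theorem dot_sub_right (u v v' : Profile n) : dot u (v - v') = dot u v - dot u v' := by
  simp only [← dotBilin_apply, map_sub]

/-- The norm on `Profile n` is the maximum of the block norms, not the one induced by `dot`. This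
one-sided comparison is enough to transfer strong monotonicity. -/
theorem sq_norm_le_dot_self (d : Profile n) : ‖d‖ ^ 2 ≤ dot d d := by
  have hnonneg : ∀ i, 0 ≤ inner ℝ (d i) (d i) := fun i => real_inner_self_nonneg
  have h : ‖d‖ ≤ √(dot d d) := by
    refine (pi_norm_le_iff_of_nonneg (Real.sqrt_nonneg _)).2 fun i => Real.le_sqrt_of_sq_le ?_
    rw [← real_inner_self_eq_norm_sq]
    exact Finset.single_le_sum (f := fun i => inner ℝ (d i) (d i)) (fun i _ => hnonneg i)
      (Finset.mem_univ i)
  exact (Real.le_sqrt (norm_nonneg _) (Finset.sum_nonneg fun i _ => hnonneg i)).1 h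

theorem dotBilin_injective : Function.Injective (dotBilin n) := by
  refine (injective_iff_map_eq_zero _).2 fun u hu => ?_
  have h : dot u u = 0 := congrArg (fun g => g u) hu
  have h' := sq_norm_le_dot_self u
  rw [h] at h'
  exact norm_eq_zero.1 (pow_eq_zero_iff two_ne_zero |>.1 (le_antisymm h' (sq_nonneg _)))

/-- Chain rule along the affine map `Function.update x i`, whose derivative is the inclusion of the
`i`-th block. -/
theorem inner_partialGrad {g : Profile n → ℝ} {x : Profile n} (hg : DifferentiableAt ℝ g x)
    (i : Fin N) (v : EuclideanSpace ℝ (Fin (n i))) :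
    inner ℝ (partialGrad g x i) v = fderiv ℝ g x (Pi.single i v) := by
  have hg' : HasFDerivAt g (fderiv ℝ g x) (Function.update x i (x i)) := by
    rw [Function.update_eq_self]
    exact hg.hasFDerivAt
  have h := hg'.comp (x i) (hasFDerivAt_update (𝕜 := ℝ) x (x i))
  rw [partialGrad, ← InnerProductSpace.toDual_apply_apply (𝕜 := ℝ), toDual_gradient]
  have hfd := h.fderiv
  simp only [Function.comp_def] at hfd
  rw [hfd, ContinuousLinearMap.comp_apply]
  congr 1
  ext1 j
  rcases eq_or_ne j i with rfl | hj
  · simp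
  · simp [hj]

theorem dot_fullGrad {g : Profile n → ℝ} {x : Profile n} (hg : DifferentiableAt ℝ g x)
    (d : Profile n) : dot (fullGrad g x) d = fderiv ℝ g x d := by
  simp only [dot, fullGrad, inner_partialGrad hg]
  rw [← map_sum, Finset.univ_sum_single]

end Dot

/-! ### Variational equilibria and the KKT system -/

namespace MultiFollowerGame

variable {N nL pL qL : ℕ} {n p q : Fin N → ℕ} {G : MultiFollowerGame N nL pL qL n p q}
  {y : EuclideanSpace ℝ (Fin nL)}

theorem mem_jointSet {x : Profile n} :
    x ∈ G.jointSet y ↔ (∀ i j, G.h i j y x ≤ 0) ∧ ∀ i k, G.l i k y x = 0 := by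
  simp [jointSet, strategySet, forall_and]

theorem isClosed_jointSet (hh : ∀ i j, Continuous (G.h i j y))
    (hl : ∀ i k, Continuous (G.l i k y)) : IsClosed (G.jointSet y) := by
  have : G.jointSet y = (⋂ i, ⋂ j, {x | G.h i j y x ≤ 0}) ∩ ⋂ i, ⋂ k, {x | G.l i k y x = 0} := by
    ext x
    simp [mem_jointSet]
  rw [this]
  exact (isClosed_iInter fun i => isClosed_iInter fun j =>
    isClosed_le (hh i j) continuous_const).inter
      (isClosed_iInter fun i => isClosed_iInter fun k => isClosed_eq (hl i k) continuous_const)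

/-- The functional `d ↦ -D(y, x)ᵀ d`, written with Fréchet derivatives. -/
noncomputable def negGradForm (G : MultiFollowerGame N nL pL qL n p q)
    (y : EuclideanSpace ℝ (Fin nL)) (x : Profile n) : Profile n →L[ℝ] ℝ :=
  -∑ i, (fderiv ℝ (G.f i y) x).comp
    ((ContinuousLinearMap.single ℝ _ i).comp (ContinuousLinearMap.proj i))

theorem negGradForm_apply {x : Profile n} (hf : ∀ i, DifferentiableAt ℝ (G.f i y) x)
    (d : Profile n) : G.negGradForm y x d = -dot (G.pseudoGrad y x) d := by
  simp [negGradForm, dot, pseudoGrad, inner_partialGrad (hf _)]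

theorem continuousOn_negGradForm
    (hC1 : ∀ x ∈ G.jointSet y, ∀ i, ContDiffAt ℝ 1 (G.f i y) x) :
    ContinuousOn (G.negGradForm y) (G.jointSet y) := by
  intro x hx
  refine ContinuousAt.continuousWithinAt ?_
  unfold negGradForm
  refine (tendsto_finsetSum _ fun i _ => ?_).neg
  have : ContinuousAt (fderiv ℝ (G.f i y)) x :=
    ((hC1 x hx i).fderiv_right (m := 0) (by simp)).continuousAt
  exact this.clm_comp continuousAt_const

/-- The operator is `negGradForm`: working with Fréchet derivatives makes its continuity immediate
from the C¹ hypothesis. -/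
theorem variationalEquilibria_nonempty
    (hC1 : ∀ x ∈ G.jointSet y, ∀ i, ContDiffAt ℝ 1 (G.f i y) x)
    (hjoint : Convex ℝ (G.jointSet y)) (hclosed : IsClosed (G.jointSet y))
    (hmono : G.StronglyMonotoneNegGradOn y (G.jointSet y)) (hne : (G.jointSet y).Nonempty) :
    (G.variationalEquilibria y).Nonempty := by
  obtain ⟨c, hc, hmono⟩ := hmono
  have hdiff : ∀ x ∈ G.jointSet y, ∀ i, DifferentiableAt ℝ (G.f i y) x := fun x hx i =>
    (hC1 x hx i).differentiableAt one_ne_zero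
  obtain ⟨x, hx, hVI⟩ := exists_variationalInequality_of_stronglyMonotone hjoint hclosed hne
    (continuousOn_negGradForm hC1) hc (fun x hx x' hx' => by
      rw [sub_apply, negGradForm_apply (hdiff x hx), negGradForm_apply (hdiff x' hx')]
      calc c * ‖x - x'‖ ^ 2 ≤ c * dot (x - x') (x - x') := by
            gcongr
            exact sq_norm_le_dot_self _
        _ ≤ _ := hmono x hx x' hx'
        _ = _ := by rw [dot_sub_left, dot_neg_left, dot_neg_left])
  refine ⟨x, hx, fun x' hx' => ?_⟩
  have h := hVI x' hx'
  rwa [negGradForm_apply (hdiff x hx), ← dot_neg_right, neg_sub] at h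

/-- The constraints of the joint feasible set are tested against a feasible direction. -/
theorem sub_mem_linearizedCone (hh : ∀ i j, Differentiable ℝ (G.h i j y))
    (hl : ∀ i k, Differentiable ℝ (G.l i k y)) (hjoint : Convex ℝ (G.jointSet y))
    {z z' : Profile n} (hz : z ∈ G.jointSet y) (hz' : z' ∈ G.jointSet y) :
    z' - z ∈ G.linearizedCone y z := by
  -- An active inequality constraint is maximal at `z` over the joint set, and an equality
  -- constraint is constant there, so first-order conditions along this tangent direction suffice;
  -- the constraint functions need not be convex.
  have htan : z' - z ∈ posTangentConeAt (G.jointSet y) z :=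
    sub_mem_posTangentConeAt_of_segment_subset (hjoint.segment_subset hz hz')
  refine ⟨fun i j hact => ?_, fun i k => ?_⟩
  · rw [dot_fullGrad (hh i j z)]
    refine IsLocalMaxOn.hasFDerivWithinAt_nonpos (s := G.jointSet y) (f := G.h i j y) ?_
      (hh i j z).hasFDerivAt.hasFDerivWithinAt htan
    exact eventually_nhdsWithin_of_forall fun x hx => by
      rw [hact]
      exact (mem_jointSet.1 hx).1 i j
  · rw [dot_fullGrad (hl i k z)]
    have heq : ∀ x ∈ G.jointSet y, G.l i k y x = G.l i k y z := fun x hx => by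
      rw [(mem_jointSet.1 hx).2, (mem_jointSet.1 hz).2]
    refine le_antisymm
      (IsLocalMaxOn.hasFDerivWithinAt_nonpos (s := G.jointSet y) (f := G.l i k y) ?_
        (hl i k z).hasFDerivAt.hasFDerivWithinAt htan)
      (IsLocalMinOn.hasFDerivWithinAt_nonneg (s := G.jointSet y) (f := G.l i k y) ?_
        (hl i k z).hasFDerivAt.hasFDerivWithinAt htan)
    · exact eventually_nhdsWithin_of_forall fun x hx => (heq x hx).le
    · exact eventually_nhdsWithin_of_forall fun x hx => (heq x hx).ge

theorem mem_jointSet_of_mem_kktSet {w : FollowerDecision n p q} (hw : w ∈ G.kktSet y) :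
    w.x ∈ G.jointSet y ∧ w.z ∈ G.jointSet y := by
  obtain ⟨-, hhx, hlx, -, hhz, hlz, -⟩ := hw
  exact ⟨mem_jointSet.2 ⟨hhx, hlx⟩, mem_jointSet.2 ⟨hhz, hlz⟩⟩

/-- A KKT point of the inner problem is a minimizer, by convexity of the joint feasible set. -/
theorem dot_sub_z_le_of_mem_kktSet (hh : ∀ i j, Differentiable ℝ (G.h i j y))
    (hl : ∀ i k, Differentiable ℝ (G.l i k y)) (hjoint : Convex ℝ (G.jointSet y))
    {w : FollowerDecision n p q} (hw : w ∈ G.kktSet y) {z' : Profile n}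
    (hz' : z' ∈ G.jointSet y) :
    dot (G.pseudoGrad y w.x) (w.x - w.z) ≤ dot (G.pseudoGrad y w.x) (w.x - z') := by
  have hd := sub_mem_linearizedCone hh hl hjoint (mem_jointSet_of_mem_kktSet hw).2 hz'
  obtain ⟨hstat, -, -, hcomp, -, -, hnonneg⟩ := hw
  -- Pair stationarity with z' - z: equality terms vanish, and complementarity leaves only active
  -- inequality terms, which are nonpositive.
  have h := congrArg (fun u => dotBilin n u (z' - w.z)) hstat
  simp only [map_add, map_neg, map_sum, map_smul, LinearMap.add_apply, LinearMap.neg_apply,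
    LinearMap.sum_apply, LinearMap.smul_apply, dotBilin_apply, smul_eq_mul, map_zero,
    LinearMap.zero_apply, hd.2, mul_zero, Finset.sum_const_zero, add_zero] at h
  have hle : ∑ i, ∑ j, w.lam i j * dot (fullGrad (G.h i j y) w.z) (z' - w.z) ≤ 0 := by
    refine Finset.sum_nonpos fun i _ => Finset.sum_nonpos fun j _ => ?_
    rcases mul_eq_zero.1 (hcomp i j) with h₀ | h₀
    · rw [h₀, zero_mul]
    · exact mul_nonpos_of_nonneg_of_nonpos (hnonneg i j) (hd.1 i j h₀)
  rw [dot_sub_right] at h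
  rw [dot_sub_right, dot_sub_right]
  linarith

/-- Under Abadie's constraint qualification, a variational equilibrium `x` is a KKT point of its
own inner problem. -/
theorem exists_mem_kktSet_of_mem_variationalEquilibria {x : Profile n}
    (hx : x ∈ G.variationalEquilibria y) (hCQ : G.AbadieCQ y x) :
    ∃ lam mu, (⟨x, x, lam, mu⟩ : FollowerDecision n p q) ∈ G.kktSet y := by
  obtain ⟨hxK, hVI⟩ := hx
  obtain ⟨c, m, hc, hc₀, hsum⟩ := exists_multipliers_of_forall_nonpos
    (fun r : (Σ i, Fin (p i)) => G.h r.1 r.2 y x = 0)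
    (fun r => dotBilin n (fullGrad (G.h r.1 r.2 y) x))
    (fun r : (Σ i, Fin (q i)) => dotBilin n (fullGrad (G.l r.1 r.2 y) x))
    (dotBilin n (G.pseudoGrad y x)) (by
      intro d hd₁ hd₂
      -- The variational inequality says that `x` maximizes the linear form D(y, x)ᵀ over the joint
      -- set, so this form is nonpositive on tangent directions.
      have htan := hCQ ⟨fun i j => hd₁ ⟨i, j⟩, fun i k => hd₂ ⟨i, k⟩⟩
      refine IsLocalMaxOn.hasFDerivWithinAt_nonpos (s := G.jointSet y)
        (f := dotBilin n (G.pseudoGrad y x)) ?_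
        ((dotBilin n (G.pseudoGrad y x)).toContinuousLinearMap.hasFDerivWithinAt) htan
      refine eventually_nhdsWithin_of_forall fun x' hx' => ?_
      have := hVI x' hx'
      rw [dot_sub_right] at this
      simpa using this)
  have hgrad : G.pseudoGrad y x = ∑ r : (Σ i, Fin (p i)), c r • fullGrad (G.h r.1 r.2 y) x
      + ∑ r : (Σ i, Fin (q i)), m r • fullGrad (G.l r.1 r.2 y) x := by
    apply dotBilin_injective
    rw [hsum]
    simp only [map_add, map_sum, map_smul]
  rw [Fintype.sum_sigma, Fintype.sum_sigma] at hgrad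
  obtain ⟨hhx, hlx⟩ := mem_jointSet.1 hxK
  refine ⟨fun i j => c ⟨i, j⟩, fun i k => m ⟨i, k⟩, ?_, hhx, hlx, fun i j => ?_, hhx, hlx,
    fun i j => hc _⟩
  · dsimp only
    rw [add_assoc, ← hgrad, neg_add_cancel]
  · by_cases h : G.h i j y x = 0
    · exact mul_eq_zero_of_right _ h
    · exact mul_eq_zero_of_left (hc₀ ⟨i, j⟩ h) _

/-- The variational equilibria are the decision parts of the best responses of the fictitious
follower. -/
theorem image_x_bestResponses
    (hC1 : ∀ x ∈ G.jointSet y, ∀ i, ContDiffAt ℝ 1 (G.f i y) x)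
    (hjoint : Convex ℝ (G.jointSet y))
    (hmono : G.StronglyMonotoneNegGradOn y (G.jointSet y))
    (hh : ∀ i j, Differentiable ℝ (G.h i j y)) (hl : ∀ i k, Differentiable ℝ (G.l i k y))
    (hCQ : ∀ z ∈ G.jointSet y, G.AbadieCQ y z) :
    FollowerDecision.x '' G.toSingleFollower.bestResponses y = G.variationalEquilibria y := by
  ext x
  constructor
  · rintro ⟨w, ⟨hw, hmax⟩, rfl⟩
    obtain ⟨hwx, -⟩ := mem_jointSet_of_mem_kktSet hw
    -- A variational equilibrium `v`, played as x = z = v, is a competitor of value 0, so the best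
    -- response has value at least 0.
    obtain ⟨v, hv⟩ := variationalEquilibria_nonempty hC1 hjoint
      (isClosed_jointSet (fun i j => (hh i j).continuous) fun i k => (hl i k).continuous)
      hmono ⟨_, hwx⟩
    obtain ⟨lam, mu, hv'⟩ := exists_mem_kktSet_of_mem_variationalEquilibria hv (hCQ v hv.1)
    have hval : 0 ≤ dot (G.pseudoGrad y w.x) (w.x - w.z) := by
      simpa [toSingleFollower, dot] using hmax _ hv'
    exact ⟨hwx, fun x' hx' => hval.trans (dot_sub_z_le_of_mem_kktSet hh hl hjoint hw hx')⟩
  · intro hx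
    obtain ⟨lam, mu, hw⟩ := exists_mem_kktSet_of_mem_variationalEquilibria hx (hCQ x hx.1)
    refine ⟨_, ⟨hw, fun w' hw' => ?_⟩, rfl⟩
    -- Comparing z' with x' itself bounds every value by 0, the value attained at x = z.
    have := dot_sub_z_le_of_mem_kktSet hh hl hjoint hw' (mem_jointSet_of_mem_kktSet hw').1
    simpa [toSingleFollower, dot] using this

end MultiFollowerGame

end Stackelberg

/-! ### Equality of the two equilibrium sets -/

theorem theorem4 {N nL pL qL : ℕ} {n p q : Fin N → ℕ}
    (G : Stackelberg.MultiFollowerGame N nL pL qL n p q)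
    -- each `Ωᵢ(y, x₋ᵢ)` is closed and convex
    (hclosed : ∀ y ∈ G.leaderSet, ∀ x ∈ G.jointSet y, ∀ i, IsClosed (G.strategySet i y x))
    (hconvex : ∀ y ∈ G.leaderSet, ∀ x ∈ G.jointSet y, ∀ i, Convex ℝ (G.strategySet i y x))
    -- each `fᵢ` is concave in `xᵢ` on `Ωᵢ(y, x₋ᵢ)`, and `C¹` in `x` near the joint feasible set
    (hconcave : ∀ y ∈ G.leaderSet, ∀ x ∈ G.jointSet y, ∀ i,
      ConcaveOn ℝ (G.strategySet i y x) (fun u => G.f i y (Function.update x i u)))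
    (hC1 : ∀ y ∈ G.leaderSet, ∀ x ∈ G.jointSet y, ∀ i, ContDiffAt ℝ 1 (G.f i y) x)
    -- the joint feasible set is convex
    (hjoint : ∀ y ∈ G.leaderSet, Convex ℝ (G.jointSet y))
    -- `-D(y, ·)` is strongly monotone on the joint feasible set
    (hmono : ∀ y ∈ G.leaderSet, G.StronglyMonotoneNegGradOn y (G.jointSet y))
    -- the followers' constraints are differentiable in `x` and satisfy a constraint qualification
    (hdiff_h : ∀ y ∈ G.leaderSet, ∀ i j, Differentiable ℝ (G.h i j y))
    (hdiff_l : ∀ y ∈ G.leaderSet, ∀ i k, Differentiable ℝ (G.l i k y))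
    (hCQ : ∀ y ∈ G.leaderSet, ∀ z ∈ G.jointSet y, G.AbadieCQ y z) :
    G.variationalStackelbergEquilibria =
      (fun e => (e.1, e.2.x)) '' G.toSingleFollower.stackelbergEquilibria := by
  have himage : ∀ y ∈ G.leaderSet, Stackelberg.FollowerDecision.x ''
      G.toSingleFollower.bestResponses y = G.variationalEquilibria y := fun y hy =>
    Stackelberg.MultiFollowerGame.image_x_bestResponses (hC1 y hy) (hjoint y hy) (hmono y hy)
      (hdiff_h y hy) (hdiff_l y hy) (hCQ y hy)
  have hinf : ∀ y ∈ G.leaderSet, (⨅ v ∈ G.variationalEquilibria y, (G.fL y v : EReal)) =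
      ⨅ w ∈ G.toSingleFollower.bestResponses y, (G.toSingleFollower.fL y w : EReal) :=
    fun y hy => by
      rw [← himage y hy, iInf_image]
      rfl
  have hsup : ∀ y ∈ G.leaderSet, (⨆ v ∈ G.variationalEquilibria y, (G.fL y v : EReal)) =
      ⨆ w ∈ G.toSingleFollower.bestResponses y, (G.toSingleFollower.fL y w : EReal) :=
    fun y hy => by
      rw [← himage y hy, iSup_image]
      rfl
  ext ⟨y, x⟩
  constructor
  · rintro ⟨hy, hx, hopt⟩
    obtain ⟨w, hw, rfl⟩ := (himage y hy).symm.subset hx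
    refine ⟨(y, w), ⟨hy, hw, fun y' hy' => ?_⟩, rfl⟩
    rw [← hinf y' hy', ← hsup y hy]
    exact hopt y' hy'
  · rintro ⟨⟨y, w⟩, ⟨hy, hw, hopt⟩, ⟨⟩⟩
    refine ⟨hy, (himage y hy).subset ⟨w, hw, rfl⟩, fun y' hy' => ?_⟩
    rw [hinf y' hy', hsup y hy]
    exact hopt y' hy'
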